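/- Let $\ell$ be an odd prime, and let $\mathcal G$ be the set of isomorphism classes of finite abelian $\ell$-groups, partially ordered by $[A]\le[B]$ if and only if there is an injective homomorphism $A\hookrightarrow B$. For $A,C\in\mathcal G$ let $\operatorname{sub}(A,C)$ be the number of subgroups of $C$ that are isomorphic to $A$. An $A$-chain is a finite linearly ordered subset $\mathfrak C=\{A_1<\cdots<A_i\}$ of $\{B\in\mathcal G : B>A\}$, and for $i\ge 1$ we set $$\operatorname{sub}(\mathfrak C)=(-1)^i\operatorname{sub}(A,A_1)\prod_{j=1}^{i-1}\operatorname{sub}(A_j,A_{j+1}).$$ Define $S:\mathcal G\times\mathcal G\to\mathbb Z$ by $S(A,C)=0$ if $A\not\le C$, $S(A,C)=1$ if $A=C$, and $$S(A,C)=\sum_{\mathfrak C\ \text{an } A\text{-chain},\ \max\mathfrak C=C}\operatorname{sub}(\mathfrak C)\qquad\text{if } A<C.$$ Then for all finite abelian $\ell$-groups $A$ and $C$, $S(A,C)=0$ unless there exists an injective homomorphism $\iota:A\hookrightarrow C$ such that $\operatorname{coker}(\iota)=C/\iota(A)$ is elementary abelian, i.e. satisfies $\ell\cdot\operatorname{coker}(\iota)=0$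 (the trivial group counts as elementary abelian). -/

import Mathlib

universe u

/-- A finite abelian `ℓ`-group (written multiplicatively). -/
structure FinAbPGroup (ℓ : ℕ) : Type (u + 1) where
  carrier : Type u
  [commGroup : CommGroup carrier]
  [finite : Finite carrier]
  isPGroup : IsPGroup ℓ carrier

namespace FinAbPGroup

attribute [instance] FinAbPGroup.commGroup FinAbPGroup.finite

/-- Two finite abelian `ℓ`-groups are equivalent when they are isomorphic. -/
instance instSetoid (ℓ : ℕ) : Setoid (FinAbPGroup.{u} ℓ) where
  r A B := Nonempty (A.carrier ≃* B.carrier)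
  iseqv :=
    { refl := fun _ => ⟨MulEquiv.refl _⟩
      symm := fun ⟨e⟩ => ⟨e.symm⟩
      trans := fun ⟨e⟩ ⟨f⟩ => ⟨e.trans f⟩ }

/-- The number of subgroups of `C` that are isomorphic to `A`. -/
noncomputable def subCount {ℓ : ℕ} (A C : FinAbPGroup.{u} ℓ) : ℕ :=
  Nat.card {H : Subgroup C.carrier // Nonempty (H ≃* A.carrier)}

theorem subCount_congr {ℓ : ℕ} (A C A' C' : FinAbPGroup.{u} ℓ) (hA : A ≈ A') (hC : C ≈ C') :
    subCount A C = subCount A' C' := by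
  obtain ⟨e⟩ := hA
  obtain ⟨f⟩ := hC
  refine Nat.card_congr (Equiv.subtypeEquiv f.mapSubgroup.toEquiv fun H => ?_)
  have k : H ≃* (f.mapSubgroup H : Subgroup C'.carrier) := f.subgroupMap H
  exact ⟨fun ⟨g⟩ => ⟨k.symm.trans (g.trans e)⟩, fun ⟨g⟩ => ⟨k.trans (g.trans e.symm)⟩⟩

end FinAbPGroup

/-- The set of isomorphism classes of finite abelian `ℓ`-groups. -/
def FinAbPClass (ℓ : ℕ) : Type (u + 1) :=
  Quotient (FinAbPGroup.instSetoid.{u} ℓ)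

namespace FinAbPClass

variable {ℓ : ℕ}

/-- The isomorphism class of a finite abelian `ℓ`-group `A`. -/
def of (A : Type u) [CommGroup A] [Finite A] (hA : IsPGroup ℓ A) : FinAbPClass.{u} ℓ :=
  Quotient.mk (FinAbPGroup.instSetoid ℓ) ⟨A, hA⟩

/-- `[A] ≤ [B]` if and only if there is an injective homomorphism from `A` to `B`. -/
instance instPartialOrder : PartialOrder (FinAbPClass.{u} ℓ) where
  le := Quotient.lift₂
    (fun A B => ∃ f : A.carrier →* B.carrier, Function.Injective f)
    (by
      rintro A B A' B' ⟨e⟩ ⟨e'⟩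
      refine propext ⟨?_, ?_⟩
      · rintro ⟨f, hf⟩
        exact ⟨(e'.toMonoidHom.comp f).comp e.symm.toMonoidHom,
          (e'.injective.comp hf).comp e.symm.injective⟩
      · rintro ⟨f, hf⟩
        exact ⟨(e'.symm.toMonoidHom.comp f).comp e.toMonoidHom,
          (e'.symm.injective.comp hf).comp e.injective⟩)
  le_refl := by
    rintro ⟨A⟩
    exact ⟨MonoidHom.id _, fun _ _ h => h⟩
  le_trans := by
    rintro ⟨A⟩ ⟨B⟩ ⟨C⟩ ⟨f, hf⟩ ⟨g, hg⟩
    exact ⟨g.comp f, hg.comp hf⟩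
  le_antisymm := by
    rintro ⟨A⟩ ⟨B⟩ ⟨f, hf⟩ ⟨g, hg⟩
    refine Quotient.sound ⟨MulEquiv.ofBijective f ?_⟩
    exact hf.bijective_of_nat_card_le (Nat.card_le_card_of_injective g hg)

/-- `sub A C` is the number of subgroups of `C` that are isomorphic to `A`. -/
noncomputable def sub (A C : FinAbPClass.{u} ℓ) : ℕ :=
  Quotient.lift₂ FinAbPGroup.subCount FinAbPGroup.subCount_congr A C

/-- An `A`-chain is a finite linearly ordered subset of `{B | B > A}`. It is given here by its
increasing enumeration `[A₁, …, Aᵢ]`, so that `A < A₁ < ⋯ < Aᵢ`. -/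
def IsAChain (A : FinAbPClass.{u} ℓ) (c : List (FinAbPClass.{u} ℓ)) : Prop :=
  (∀ B ∈ c, A < B) ∧ c.Pairwise (· < ·)

/-- For the chain `[A₁, …, Aᵢ]`, this is
`(-1)ⁱ * sub A A₁ * sub A₁ A₂ * ⋯ * sub Aᵢ₋₁ Aᵢ`. -/
noncomputable def subChain (A : FinAbPClass.{u} ℓ) : List (FinAbPClass.{u} ℓ) → ℤ
  | [] => 1
  | B :: c => -(sub A B : ℤ) * subChain B c

/-- The set of `A`-chains with maximum `C`. -/
def chainsTo (A C : FinAbPClass.{u} ℓ) : Set (List (FinAbPClass.{u} ℓ)) :=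
  {c | IsAChain A c ∧ IsGreatest {B | B ∈ c} C}

theorem finite_Iic (C : FinAbPClass.{u} ℓ) : (Set.Iic C).Finite := by
  obtain ⟨C⟩ := C
  let F : Subgroup C.carrier → FinAbPClass.{u} ℓ := fun H => of H (C.isPGroup.to_subgroup H)
  refine (Set.finite_range F).subset ?_
  rintro ⟨B⟩ ⟨f, hf⟩
  exact ⟨f.range, Quotient.sound ⟨(MonoidHom.ofInjective hf).symm⟩⟩

theorem finite_chainsTo (A C : FinAbPClass.{u} ℓ) : (chainsTo A C).Finite := by
  classical
  refine Set.Finite.of_finite_image (f := fun c => {B | B ∈ c})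
    ((finite_Iic C).finite_subsets.subset ?_) ?_
  · rintro _ ⟨c, hc, rfl⟩
    exact fun B hB => hc.2.2 hB
  · intro c hc d hd h
    have hc' := hc.1.2
    have hd' := hd.1.2
    refine List.Perm.eq_of_pairwise (le := (· < ·)) ?_ hc' hd' ?_
    · intro a b _ _ h₁ h₂
      exact absurd h₁ h₂.asymm
    · refine (List.perm_ext_iff_of_nodup (hc'.imp fun h => h.ne) (hd'.imp fun h => h.ne)).2 ?_
      exact fun a => Set.ext_iff.1 h a

open Classical in
/-- The Möbius-type function `S` on pairs of isomorphism classes. -/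
noncomputable def S (A C : FinAbPClass.{u} ℓ) : ℤ :=
  if ¬ A ≤ C then 0
  else if A = C then 1
  else ∑ c ∈ (finite_chainsTo A C).toFinset, subChain A c

end FinAbPClass

/-- An elementary abelian `ℓ`-group: abelian, with every element killed by `ℓ`. The trivial group
is elementary abelian. -/
def IsElementaryAbelian (ℓ : ℕ) (G : Type u) [Group G] : Prop :=
  (∀ x y : G, x * y = y * x) ∧ ∀ x : G, x ^ ℓ = 1

/-! Splitting off the smallest member of a chain gives `S` the recursion of the Möbius function of
the subgroup lattice of `C`, collected by isomorphism class. Hence `S(A, C)` is the sum of `μ(H, C)`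
over the subgroups `H ≅ A` (`S_eq_mobiusSum`). The ℓ-th powers `C^ℓ` consist of non-generators, so
`μ(H, C) = 0` unless `C^ℓ ≤ H` (`mu_top_eq_zero_of_not_le`). But `C^ℓ ≤ H ≅ A` would give an
embedding of `A` with elementary abelian cokernel. -/

/-! ### Möbius function and non-generators -/

section MobiusFrattini

open Finset IncidenceAlgebra

/-- If joining with `φ` never turns a proper element into `⊤`, then the Möbius function `μ(x, ⊤)`
is supported on the elements above `φ`. -/
theorem mu_top_eq_zero_of_not_le {α : Type*} [Lattice α] [OrderTop α] [LocallyFiniteOrder α]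
    [WellFoundedGT α] [DecidableEq α] {φ : α} (hφ : ∀ x, x ⊔ φ = ⊤ → x = ⊤) (x : α)
    (hx : ¬ φ ≤ x) : mu ℤ x ⊤ = 0 := by
  induction x using WellFoundedGT.induction with
  | ind x ih =>
    have hne : x ≠ ⊤ := fun h => hx (h ▸ le_top)
    have hlt : x < x ⊔ φ := left_lt_sup.2 hx
    -- By induction only `y ≥ φ` contribute, so the sum runs over `[x ⊔ φ, ⊤]`; it vanishes because
    -- `x ⊔ φ ≠ ⊤`.
    have hsum : ∑ y ∈ Icc (x ⊔ φ) ⊤, mu ℤ y ⊤ = ∑ y ∈ Ioc x ⊤, mu ℤ y ⊤ := by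
      refine sum_subset (fun y hy => ?_) fun y hy hy' => ?_
      · exact mem_Ioc.2 ⟨hlt.trans_le (mem_Icc.1 hy).1, le_top⟩
      · refine ih y (mem_Ioc.1 hy).1 fun h => hy' ?_
        exact mem_Icc.2 ⟨sup_le (mem_Ioc.1 hy).1.le h, le_top⟩
    rw [mu_eq_neg_sum_Ioc_of_ne hne, ← hsum, sum_Icc_mu_left,
      if_neg fun h => hne (hφ x h), neg_zero]

end MobiusFrattini

/-- In a finite abelian `p`-group, the subgroup of `p`-th powers consists of non-generators. -/
theorem IsPGroup.eq_top_of_sup_range_powMonoidHom_eq_top {p : ℕ} {G : Type*} [CommGroup G]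
    (hG : IsPGroup p G) [Finite G] (H : Subgroup G)
    (h : H ⊔ (powMonoidHom p : G →* G).range = ⊤) : H = ⊤ := by
  -- Iterating `G = H · G^p` gives `G = H · G^(p^n)`, and the last factor is trivial once `p^n`
  -- kills `G`.
  have hstep : ∀ n : ℕ, ∀ g : G, ∃ k : G, g / k ^ p ^ n ∈ H := by
    intro n
    induction n with
    | zero => exact fun g => ⟨g, by simp⟩
    | succ n ih =>
      intro g
      obtain ⟨k, hk⟩ := ih g
      obtain ⟨a, ha, _, ⟨b, rfl⟩, hab⟩ := Subgroup.mem_sup.1 (h ▸ Subgroup.mem_top k)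
      refine ⟨b, ?_⟩
      have : g / b ^ p ^ (n + 1) = g / k ^ p ^ n * a ^ p ^ n := by
        rw [← hab, powMonoidHom_apply, mul_pow, ← pow_mul, ← pow_succ', div_mul_eq_mul_div,
          mul_comm g, mul_div_mul_left_eq_div]
      rw [this]
      exact H.mul_mem hk (H.pow_mem ha _)
  obtain ⟨n, hn⟩ : ∃ n : ℕ, ∀ g : G, g ^ p ^ n = 1 := by
    choose f hf using hG
    cases nonempty_fintype G
    refine ⟨Finset.univ.sup f, fun g => ?_⟩
    exact orderOf_dvd_iff_pow_eq_one.1 ((orderOf_dvd_of_pow_eq_one (hf g)).trans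
      (pow_dvd_pow p (Finset.le_sup (Finset.mem_univ g))))
  refine (Subgroup.eq_top_iff' H).2 fun g => ?_
  obtain ⟨k, hk⟩ := hstep n g
  simpa [hn] using hk

theorem isElementaryAbelian_quotient {p : ℕ} {G : Type u} [CommGroup G] {H : Subgroup G}
    (h : (powMonoidHom p : G →* G).range ≤ H) : IsElementaryAbelian p (G ⧸ H) := by
  refine ⟨mul_comm, fun x => ?_⟩
  obtain ⟨g, rfl⟩ := QuotientGroup.mk_surjective x
  exact (QuotientGroup.eq_one_iff (g ^ p)).2 (h ⟨g, rfl⟩)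

/-! ### Recursion for `S` over chains -/

namespace FinAbPClass

variable {ℓ : ℕ}

theorem S_of_le {A C : FinAbPClass.{u} ℓ} (h : A < C) :
    S A C = ∑ c ∈ (finite_chainsTo A C).toFinset, subChain A c := by
  rw [S, if_neg (not_not.2 h.le), if_neg h.ne]

theorem S_self (A : FinAbPClass.{u} ℓ) : S A A = 1 := by
  simp [S]

theorem nil_notMem_chainsTo (A C : FinAbPClass.{u} ℓ) : [] ∉ chainsTo A C :=
  fun h => List.not_mem_nil h.2.1

/-- A chain ending in `C` is its first element `B` followed by a `B`-chain ending in `C`, which is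
empty exactly if `B = C`. -/
theorem cons_mem_chainsTo_iff {A B C : FinAbPClass.{u} ℓ} {c : List (FinAbPClass.{u} ℓ)} :
    B :: c ∈ chainsTo A C ↔ A < B ∧ (B = C ∧ c = [] ∨ B < C ∧ c ∈ chainsTo B C) := by
  constructor
  · rintro ⟨⟨h₁, h₂⟩, h₃, h₄⟩
    obtain ⟨h₅, h₆⟩ := List.pairwise_cons.1 h₂
    refine ⟨h₁ B (by simp), ?_⟩
    have hBC : B ≤ C := h₄ (show B ∈ B :: c by simp)
    have hc : ∀ D ∈ c, D ≤ C := fun D hD => h₄ (show D ∈ B :: c by simp [hD])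
    rcases hBC.eq_or_lt with h | h
    · exact Or.inl ⟨h, List.eq_nil_iff_forall_not_mem.2 fun D hD =>
        absurd (h₅ D hD) (h ▸ hc D hD).not_gt⟩
    · exact Or.inr ⟨h, ⟨h₅, h₆⟩, (List.mem_cons.1 h₃).resolve_left h.ne', hc⟩
  · rintro ⟨hAB, ⟨rfl, rfl⟩ | ⟨hBC, ⟨h₁, h₂⟩, h₃, h₄⟩⟩
    · simp [chainsTo, IsAChain, hAB]
    · refine ⟨⟨?_, List.pairwise_cons.2 ⟨h₁, h₂⟩⟩, List.mem_cons_of_mem _ h₃, ?_⟩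
      · rintro D hD
        rcases List.mem_cons.1 hD with rfl | hD
        exacts [hAB, hAB.trans (h₁ D hD)]
      · rintro D hD
        rcases List.mem_cons.1 hD with rfl | hD
        exacts [hBC.le, h₄ hD]

theorem finite_Ioc (A C : FinAbPClass.{u} ℓ) : (Set.Ioc A C).Finite :=
  (finite_Iic C).subset fun _ h => h.2

/-- `S` satisfies the recursion obtained by splitting off the smallest element of a chain. -/
theorem S_eq_neg_sum {A C : FinAbPClass.{u} ℓ} (h : A < C) :
    S A C = -∑ B ∈ (finite_Ioc A C).toFinset, (sub A B : ℤ) * S B C := by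
  classical
  -- No chain runs from `C` to `C`, yet `S C C = 1`; the empty list, of weight 1, supplies this
  -- value.
  let t : FinAbPClass.{u} ℓ → Finset (List (FinAbPClass.{u} ℓ)) := fun B =>
    if B = C then {[]} else (finite_chainsTo B C).toFinset
  have ht : ∀ B ≤ C, S B C = ∑ c ∈ t B, subChain B c := by
    intro B hB
    rcases hB.eq_or_lt with rfl | hB
    · simp [t, S_self, subChain]
    · simp only [t, if_neg hB.ne, S_of_le hB]
  have hunion : (finite_chainsTo A C).toFinset =
      (finite_Ioc A C).toFinset.biUnion fun B => (t B).image (List.cons B) := by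
    ext c
    cases c with
    | nil => simp [nil_notMem_chainsTo]
    | cons B c =>
      by_cases hBC : B = C
      · simp [cons_mem_chainsTo_iff, t, hBC, eq_comm]
      · simp [cons_mem_chainsTo_iff, t, hBC, lt_iff_le_and_ne, and_assoc]
  rw [S_of_le h, hunion, Finset.sum_biUnion, ← Finset.sum_neg_distrib]
  · refine Finset.sum_congr rfl fun B hB => ?_
    rw [Finset.sum_image fun _ _ _ _ h => (List.cons.inj h).2,
      ht B ((finite_Ioc A C).mem_toFinset.1 hB).2, Finset.mul_sum, ← Finset.sum_neg_distrib]
    exact Finset.sum_congr rfl fun c _ => neg_mul _ _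
  · intro B _ B' _ hne
    refine Finset.disjoint_left.2 fun c hc hc' => hne ?_
    obtain ⟨_, _, rfl⟩ := Finset.mem_image.1 hc
    obtain ⟨_, _, h⟩ := Finset.mem_image.1 hc'
    exact (List.cons.inj h).1.symm

/-! ### Passage to the subgroup lattice of `C` -/

section Group

variable {C : Type u} [CommGroup C] [Finite C] (hC : IsPGroup ℓ C)

/-- The isomorphism class of a subgroup. -/
def ofSubgroup (H : Subgroup C) : FinAbPClass.{u} ℓ :=
  of H (hC.to_subgroup H)

theorem of_eq_of_iff {A B : Type u} [CommGroup A] [Finite A] [CommGroup B] [Finite B]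
    {hA : IsPGroup ℓ A} {hB : IsPGroup ℓ B} : of A hA = of B hB ↔ Nonempty (A ≃* B) :=
  ⟨fun h => Quotient.exact h, fun h => Quotient.sound h⟩

theorem ofSubgroup_top : ofSubgroup hC ⊤ = of C hC :=
  of_eq_of_iff.2 ⟨Subgroup.topEquiv⟩

theorem ofSubgroup_lt {H K : Subgroup C} (h : H < K) : ofSubgroup hC H < ofSubgroup hC K := by
  refine lt_of_le_of_ne ⟨Subgroup.inclusion h.le, Subgroup.inclusion_injective h.le⟩ fun he => ?_
  obtain ⟨e⟩ := of_eq_of_iff.1 he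
  exact h.ne (Subgroup.eq_of_le_of_card_ge h.le (Nat.card_congr e.toEquiv).ge)

theorem ofSubgroup_strictMono : StrictMono (ofSubgroup hC) :=
  fun _ _ => ofSubgroup_lt hC

theorem ofSubgroup_le (H : Subgroup C) : ofSubgroup hC H ≤ of C hC :=
  ofSubgroup_top hC ▸ (ofSubgroup_strictMono hC).monotone le_top

theorem ofSubgroup_eq_of_iff (H : Subgroup C) : ofSubgroup hC H = of C hC ↔ H = ⊤ :=
  ⟨fun h => by_contra fun hne =>
    (ofSubgroup_lt hC (lt_top_iff_ne_top.2 hne)).ne (h.trans (ofSubgroup_top hC).symm),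
    fun h => h ▸ ofSubgroup_top hC⟩

/-- Subgroups of `K` are subgroups of `C` below `K`, so every count takes place in one lattice. -/
theorem sub_ofSubgroup (A : FinAbPClass.{u} ℓ) (K : Subgroup C) :
    sub A (ofSubgroup hC K) = Nat.card {H : Subgroup C // H ≤ K ∧ ofSubgroup hC H = A} := by
  obtain ⟨A⟩ := A
  refine Nat.card_congr (Equiv.trans (Equiv.subtypeEquiv
    (q := fun H : {H : Subgroup C // H ≤ K} => ofSubgroup hC H.1 = Quotient.mk _ A)
    (Subgroup.MapSubtype.orderIso K).toEquiv fun H => ?_)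
    (Equiv.subtypeSubtypeEquivSubtypeInter (· ≤ K) fun H => ofSubgroup hC H = Quotient.mk _ A))
  have k : H ≃* H.map K.subtype := H.equivMapOfInjective _ K.subtype_injective
  exact ⟨fun ⟨g⟩ => Quotient.sound ⟨k.symm.trans g⟩, fun h => (of_eq_of_iff.1 h).map k.trans⟩

section Mobius

open Finset IncidenceAlgebra

variable [Fintype (Subgroup C)] [LocallyFiniteOrder (Subgroup C)] [DecidableEq (Subgroup C)]

open Classical in
/-- The sum of the Möbius function `μ(H, C)` over the subgroups `H` of `C` in the class `A`. -/
noncomputable def mobiusSum (A : FinAbPClass.{u} ℓ) : ℤ :=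
  ∑ H : Subgroup C with ofSubgroup hC H = A, mu ℤ H ⊤

theorem mobiusSum_of : mobiusSum hC (of C hC) = 1 := by
  classical
  simp [mobiusSum, ofSubgroup_eq_of_iff, Finset.filter_eq']

/-- The Möbius recursion at each `H` in the class `A`, summed over `H`. After exchanging sums, each
`K` is counted once for every `H < K` in that class, a number depending only on the class of `K`.
The result has the shape of `S_eq_neg_sum`. -/
theorem mobiusSum_eq_neg_sum {A : FinAbPClass.{u} ℓ} (h : A < of C hC) :
    mobiusSum hC A =
      -∑ B ∈ (finite_Ioc A (of C hC)).toFinset, (sub A B : ℤ) * mobiusSum hC B := by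
  classical
  have hcard : ∀ K : Subgroup C, A < ofSubgroup hC K →
      (sub A (ofSubgroup hC K) : ℤ) = #{H : Subgroup C | ofSubgroup hC H = A ∧ H < K} := by
    intro K hK
    rw [sub_ofSubgroup, Nat.card_eq_fintype_card, Fintype.card_subtype]
    congr 2
    ext H
    simp only [mem_filter, mem_univ, true_and]
    constructor
    · rintro ⟨h₁, rfl⟩
      exact ⟨rfl, lt_of_le_of_ne h₁ fun h => hK.ne (h ▸ rfl)⟩
    · exact fun ⟨h₁, h₂⟩ => ⟨h₂.le, h₁⟩
  calc mobiusSum hC A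
      = -∑ H : Subgroup C with ofSubgroup hC H = A, ∑ K : Subgroup C with H < K, mu ℤ K ⊤ := by
        rw [mobiusSum, ← sum_neg_distrib]
        refine sum_congr rfl fun H hH => ?_
        have hne : H ≠ ⊤ := fun h' =>
          h.ne ((mem_filter.1 hH).2.symm.trans ((ofSubgroup_eq_of_iff hC H).2 h'))
        rw [mu_eq_neg_sum_Ioc_of_ne hne]
        congr 2
        ext K
        simp
    _ = -∑ K : Subgroup C with A < ofSubgroup hC K,
          (sub A (ofSubgroup hC K) : ℤ) * mu ℤ K ⊤ := by
        rw [sum_comm' (t' := {K : Subgroup C | A < ofSubgroup hC K})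
          (s' := fun K => {H : Subgroup C | ofSubgroup hC H = A ∧ H < K})]
        · congr 1
          refine sum_congr rfl fun K hK => ?_
          rw [sum_const, hcard K (mem_filter.1 hK).2, nsmul_eq_mul]
        · intro H K
          simp only [mem_filter, mem_univ, true_and]
          refine ⟨fun h' => ⟨h', ?_⟩, fun h' => h'.1⟩
          exact h'.1 ▸ ofSubgroup_lt hC h'.2
    _ = _ := by
        congr 1
        rw [← sum_fiberwise_of_maps_to (g := ofSubgroup hC)
          (t := (finite_Ioc A (of C hC)).toFinset)]
        · refine sum_congr rfl fun B hB => ?_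
          rw [mobiusSum, mul_sum, filter_filter]
          have hB' : A < B := ((finite_Ioc A _).mem_toFinset.1 hB).1
          refine sum_congr ?_ fun K hK => by rw [(mem_filter.1 hK).2]
          ext K
          simp only [mem_filter, mem_univ, true_and]
          exact ⟨fun h => h.2, fun h => ⟨h ▸ hB', h⟩⟩
        · intro K hK
          exact (finite_Ioc A _).mem_toFinset.2 ⟨(mem_filter.1 hK).2, ofSubgroup_le hC K⟩

/-- `S(A, C)` is the sum of the Möbius function of the subgroup lattice of `C` over the subgroups
isomorphic to `A`. -/
theorem S_eq_mobiusSum (A : FinAbPClass.{u} ℓ) (h : A ≤ of C hC) :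
    S A (of C hC) = mobiusSum hC A := by
  -- The recursion moves from `A` up to larger classes `B`, which shrinks the interval below `C`.
  induction hn : (Set.Ioc A (of C hC)).ncard using Nat.strong_induction_on generalizing A with
  | _ n ih =>
    rcases h.eq_or_lt with rfl | hlt
    · rw [S_self, mobiusSum_of]
    · rw [S_eq_neg_sum hlt, mobiusSum_eq_neg_sum hC hlt]
      congr 1
      refine sum_congr rfl fun B hB => ?_
      obtain ⟨hAB, hBC⟩ := (finite_Ioc A _).mem_toFinset.1 hB
      rw [ih _ (hn ▸ Set.ncard_lt_ncard ?_ (finite_Ioc A _)) B hBC rfl]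
      exact ⟨Set.Ioc_subset_Ioc_left hAB.le, fun h' => (h' ⟨hAB, hBC⟩).1.false⟩

end Mobius

end Group

end FinAbPClass

theorem mainTheorem3 (ℓ : ℕ) (hℓ : ℓ.Prime) (hodd : Odd ℓ)
    (A C : Type u) [CommGroup A] [Finite A] [CommGroup C] [Finite C]
    (hA : IsPGroup ℓ A) (hC : IsPGroup ℓ C)
    (h : ¬ ∃ ι : A →* C, Function.Injective ι ∧ IsElementaryAbelian ℓ (C ⧸ ι.range)) :
    FinAbPClass.S (FinAbPClass.of A hA) (FinAbPClass.of C hC) = 0 := by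
  classical
  by_cases hle : FinAbPClass.of A hA ≤ FinAbPClass.of C hC
  · let _ : Fintype (Subgroup C) := Fintype.ofFinite _
    let _ : LocallyFiniteOrder (Subgroup C) := Fintype.toLocallyFiniteOrder
    rw [FinAbPClass.S_eq_mobiusSum hC _ hle, FinAbPClass.mobiusSum]
    refine Finset.sum_eq_zero fun H hH => ?_
    obtain ⟨e⟩ := FinAbPClass.of_eq_of_iff.1 (Finset.mem_filter.1 hH).2
    refine mu_top_eq_zero_of_not_le (φ := (powMonoidHom ℓ : C →* C).range)
      hC.eq_top_of_sup_range_powMonoidHom_eq_top H fun hpow => h ?_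
    refine ⟨H.subtype.comp e.symm.toMonoidHom,
      H.subtype_injective.comp e.symm.injective, isElementaryAbelian_quotient ?_⟩
    rintro x hx
    exact ⟨e ⟨x, hpow hx⟩, by simp⟩
  · rw [FinAbPClass.S, if_pos hle]
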